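/- Consider finite graphs embedded in the plane $\mathbb{R}^2$: finitely many vertices, joined by finitely many edges that are continuous curves without self-crossings and meet each other and the vertices only at their endpoints (multiple edges and loops are allowed). Every vertex has degree at least three, but components that are simple closed curves without vertices, such as disjoint circles, are also allowed. The length of a graph is the sum of the lengths of its edges. Such a graph encloses and separates areas $A_1, A_2, A_3 > 0$ if the connected components of its complement can be grouped into four regions (not necessarily connected), three of which have areas $A_1$, $A_2$, $A_3$, respectively, while the fourth, the exterior region, has infinite area. Let $L(A_1,A_2,A_3)$ be the least length needed to enclose and separate the areas $A_1, A_2, A_3$, i.e. the infimum of the lengths of all such graphs that enclose and separate these areas. **Lemma 2.2.** $L(A_1,A_2,A_3)$ is finite for all $A_1, A_2, A_3 > 0$, and the function $L$ is continuous on $\{(A_1,A_2,A_3) : A_i > 0 \text{ for } i = 1,2,3\}$. -/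

import Mathlib

open scoped ENNReal unitInterval
open MeasureTheory

/-- The Euclidean plane. -/
abbrev Plane : Type := EuclideanSpace ℝ (Fin 2)

/-- A finite graph embedded in the plane. Several edges may join the same two vertices, and
loops are allowed. Every vertex has degree at least three, with one exception: a simple closed
curve that meets the rest of the graph nowhere (for instance a disjoint circle) is a component
of its own; it is given by a loop at an arbitrarily marked point of the curve, and this
marked point is then the only kind of vertex of degree two. -/
structure EmbeddedGraph where
  /-- the vertices -/
  verts : Finset Plane
  /-- the number of edges -/
  numEdges : ℕ
  /-- the edges, as parametrized curves -/
  edge : Fin numEdges → C(I, Plane)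
  /-- edges start and end at vertices -/
  source_mem : ∀ e, edge e 0 ∈ verts
  target_mem : ∀ e, edge e 1 ∈ verts
  /-- an edge does not cross itself -/
  edge_injOn : ∀ e, Set.InjOn (edge e) (Set.Ioo 0 1)
  /-- an edge does not pass through a vertex -/
  edge_notMem_verts : ∀ e, ∀ t ∈ Set.Ioo (0 : I) 1, edge e t ∉ verts
  /-- different edges do not cross -/
  edge_disjoint : ∀ e f, e ≠ f →
    Disjoint (edge e '' Set.Ioo 0 1) (edge f '' Set.Ioo 0 1)
  /-- a vertex has at least three edge ends, unless it is the marked point of a simple closed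
  curve that is a component of its own -/
  three_le_degree : ∀ v ∈ verts,
    3 ≤ {e | edge e 0 = v}.ncard + {e | edge e 1 = v}.ncard ∨
    ({e | edge e 0 = v}.ncard + {e | edge e 1 = v}.ncard = 2 ∧
      ∃ e, edge e 0 = v ∧ edge e 1 = v)

namespace EmbeddedGraph

/-- The subset of the plane covered by the graph. -/
def support (G : EmbeddedGraph) : Set Plane :=
  (G.verts : Set Plane) ∪ ⋃ e, Set.range (G.edge e)

/-- The total length of the edges (infinite if some edge is not rectifiable). -/
noncomputable def length (G : EmbeddedGraph) : ℝ≥0∞ :=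
  ∑ e, eVariationOn (G.edge e) Set.univ

/-- `G` encloses and separates the areas `A i`: the complement of `G` is split into `n + 1`
regions, `n` interior ones `R (some i)` with areas `A i`, and an exterior one `R none` with
infinite area. Regions need not be connected, and the exterior region may have bounded
components. A region is a union of connected components of the complement of `G`; as that
complement is open in the plane, splitting it into such regions is the same as splitting it
into pairwise disjoint open sets. -/
def Encloses (G : EmbeddedGraph) {n : ℕ} (A : Fin n → ℝ) : Prop :=
  ∃ R : Option (Fin n) → Set Plane,
    (∀ i, IsOpen (R i)) ∧
    (∀ i j, i ≠ j → Disjoint (R i) (R j)) ∧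
    (⋃ i, R i) = G.supportᶜ ∧
    (∀ i, volume (R (some i)) = ENNReal.ofReal (A i)) ∧
    volume (R none) = ∞

end EmbeddedGraph

/-- The least length needed to enclose and separate the areas `A i`: the infimum of the lengths
of all embedded graphs that do so. -/
noncomputable def leastLength {n : ℕ} (A : Fin n → ℝ) : ℝ≥0∞ :=
  ⨅ (G : EmbeddedGraph) (_ : G.Encloses A), G.length

open Filter Topology

namespace EmbeddedGraph

/-! Only two constructions are needed; no minimizer and no lower bound on length enters. A homothety
of factor `c` multiplies areas by `c ^ 2` and lengths by `|c|` (`leastLength_smul_le`). A circle of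
radius `r` drawn in the exterior region, its disc assigned to region `i`, adds `π r ^ 2` to `A i` at
cost at most `2 π r` (`Encloses.exists_add`). Circles added to the empty graph give finiteness. For
continuity, choose `s` near `1` with `s • A ≤ B`, shrink `A` to `s • A` and fill up to `B` with
circles: `L(B) ≤ √s L(A) + Σ 2π √((B i - s A i) / π)`. This bound tends to `L(A)` as `B → A`;
exchanging `A` and `B` bounds `L(B)` from below, and a squeeze finishes. -/

theorem edge_mem_support (G : EmbeddedGraph) (e : Fin G.numEdges) (t : I) :
    G.edge e t ∈ G.support :=
  Or.inr (Set.mem_iUnion.2 ⟨e, t, rfl⟩)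

theorem isBounded_support (G : EmbeddedGraph) : Bornology.IsBounded G.support :=
  (G.verts.finite_toSet.isCompact.union
    (isCompact_iUnion fun e => isCompact_range (G.edge e).continuous)).isBounded

/-- The graph without vertices and edges. -/
def empty : EmbeddedGraph where
  verts := ∅
  numEdges := 0
  edge := Fin.elim0
  source_mem e := e.elim0
  target_mem e := e.elim0
  edge_injOn e := e.elim0
  edge_notMem_verts e := e.elim0
  edge_disjoint e := e.elim0
  three_le_degree v hv := absurd hv (Finset.notMem_empty v)

theorem length_empty : empty.length = 0 :=
  Finset.sum_of_isEmpty (ι := Fin 0) _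

theorem support_empty : empty.support = ∅ := by
  have : IsEmpty (Fin empty.numEdges) := inferInstanceAs (IsEmpty (Fin 0))
  simp [support, empty]

theorem encloses_empty (n : ℕ) : empty.Encloses (0 : Fin n → ℝ) := by
  refine ⟨fun o => o.elim Set.univ fun _ => ∅, ?_, ?_, ?_, ?_, ?_⟩
  · rintro (_ | i) <;> simp
  · rintro (_ | i) (_ | j) h <;> simp_all
  · rw [support_empty, Set.compl_empty]
    exact Set.eq_univ_of_subset (Set.subset_iUnion _ none) rfl
  · simp
  · simp

/-! ### Homotheties -/

/-- The image of a graph under a homothety. -/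
def scale (G : EmbeddedGraph) (c : ℝ) (hc : c ≠ 0) : EmbeddedGraph where
  verts := G.verts.map ⟨(c • ·), smul_right_injective Plane hc⟩
  numEdges := G.numEdges
  edge e := ⟨fun t => c • G.edge e t, by fun_prop⟩
  source_mem e := Finset.mem_map_of_mem _ (G.source_mem e)
  target_mem e := Finset.mem_map_of_mem _ (G.target_mem e)
  edge_injOn e s hs t ht h := G.edge_injOn e hs ht (smul_right_injective Plane hc h)
  edge_notMem_verts e t ht h :=
    G.edge_notMem_verts e t ht
      ((Finset.mem_map' ⟨(c • ·), smul_right_injective Plane hc⟩).1 h)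
  edge_disjoint e f hef := by
    rw [Set.disjoint_left]
    rintro _ ⟨s, hs, rfl⟩ ⟨t, ht, h⟩
    exact Set.disjoint_left.1 (G.edge_disjoint e f hef) ⟨s, hs, rfl⟩
      ⟨t, ht, smul_right_injective Plane hc h⟩
  three_le_degree v hv := by
    obtain ⟨w, hw, rfl⟩ := Finset.mem_map.1 hv
    simpa [(smul_right_injective Plane hc).eq_iff] using G.three_le_degree w hw

theorem support_scale (G : EmbeddedGraph) (c : ℝ) (hc : c ≠ 0) :
    (G.scale c hc).support = (c • ·) '' G.support := by
  rw [support, support, Set.image_union, Set.image_iUnion]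
  congr 1
  · simp [scale]
  · refine Set.iUnion_congr fun e => ?_
    rw [← Set.range_comp]
    rfl

theorem length_scale_le (G : EmbeddedGraph) (c : ℝ) (hc : c ≠ 0) :
    (G.scale c hc).length ≤ ‖c‖₊ * G.length := by
  rw [length, length, Finset.mul_sum]
  exact Finset.sum_le_sum fun e _ =>
    (lipschitzWith_smul c).lipschitzOnWith.comp_eVariationOn_le (Set.mapsTo_univ _ _)

open scoped Pointwise in
theorem Encloses.scale {G : EmbeddedGraph} {n : ℕ} {A : Fin n → ℝ} (h : G.Encloses A)
    (c : ℝ) (hc : c ≠ 0) : (G.scale c hc).Encloses (c ^ 2 • A) := by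
  obtain ⟨R, hopen, hdisj, hun, hvol, hinf⟩ := h
  have hvol' : ∀ s : Set Plane, volume (c • s) = ENNReal.ofReal (c ^ 2) * volume s := by
    intro s
    rw [Measure.addHaar_smul, finrank_euclideanSpace_fin, abs_of_nonneg (sq_nonneg c)]
  refine ⟨fun o => c • R o, fun o => (hopen o).smul₀ hc, fun i j hij => ?_, ?_, fun i => ?_, ?_⟩
  · exact (Set.disjoint_image_iff (smul_right_injective Plane hc)).2 (hdisj i j hij)
  · rw [support_scale, ← Set.image_compl_eq (MulAction.bijective₀ hc), ← hun, Set.image_iUnion]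
    rfl
  · rw [hvol', hvol, ← ENNReal.ofReal_mul (sq_nonneg c)]
    rfl
  · rw [hvol', hinf, ENNReal.mul_top]
    simpa using hc

/-! ### Adding a disjoint closed curve -/

/-- A graph together with a disjoint simple closed curve. -/
def addLoop (G : EmbeddedGraph) (γ : C(I, Plane)) (hclosed : γ 1 = γ 0)
    (hinj : Set.InjOn γ (Set.Ico 0 1)) (hdisj : Disjoint (Set.range γ) G.support) :
    EmbeddedGraph where
  verts := G.verts.cons (γ 0) fun h => Set.disjoint_left.1 hdisj ⟨0, rfl⟩ (Or.inl h)
  numEdges := G.numEdges + 1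
  edge := Fin.cons γ G.edge
  source_mem := Fin.cases (Finset.mem_cons_self _ _)
    fun e => Finset.mem_cons_of_mem (G.source_mem e)
  target_mem := Fin.cases (by simp [hclosed])
    fun e => Finset.mem_cons_of_mem (G.target_mem e)
  edge_injOn := Fin.cases (hinj.mono Set.Ioo_subset_Ico_self) G.edge_injOn
  edge_notMem_verts := by
    refine Fin.cases (fun t ht h => ?_) (fun e t ht h => ?_)
    -- Injectivity on `Ico 0 1`, including `0`, keeps the open edge off its marked point.
    · rcases Finset.mem_cons.1 h with h | h
      · exact ht.1.ne' (hinj ⟨ht.1.le, ht.2⟩ ⟨le_rfl, zero_lt_one⟩ h)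
      · exact Set.disjoint_left.1 hdisj ⟨t, rfl⟩ (Or.inl h)
    · rcases Finset.mem_cons.1 h with h | h
      · exact Set.disjoint_left.1 hdisj ⟨0, rfl⟩ (h ▸ G.edge_mem_support e t)
      · exact G.edge_notMem_verts e t ht h
  edge_disjoint := by
    have hγ : ∀ e, Disjoint (γ '' Set.Ioo 0 1) (G.edge e '' Set.Ioo 0 1) := fun e =>
      hdisj.mono (Set.image_subset_range _ _)
        (Set.image_subset_iff.2 fun t _ => G.edge_mem_support e t)
    refine Fin.cases (Fin.cases (fun h => absurd rfl h) fun f _ => hγ f)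
      fun e => Fin.cases (fun _ => (hγ e).symm) fun f hef => G.edge_disjoint e f ?_
    exact fun h => hef (congrArg _ h)
  three_le_degree v hv := by
    have hcons : ∀ (t : I) (v : Plane), {e | (Fin.cons γ G.edge : Fin (G.numEdges + 1) →
        C(I, Plane)) e t = v} = {e | e = 0 ∧ γ t = v} ∪ Fin.succ '' {e | G.edge e t = v} := by
      intro t v
      ext e
      refine Fin.cases ?_ (fun e => ?_) e <;> simp
    rcases Finset.mem_cons.1 hv with rfl | hv
    · have hG : ∀ t, {e | G.edge e t = γ 0} = ∅ := fun t =>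
        Set.eq_empty_of_forall_notMem fun e he =>
          Set.disjoint_left.1 hdisj ⟨0, rfl⟩ (he ▸ G.edge_mem_support e t)
      right
      rw [hcons, hcons, hG, hG]
      exact ⟨by simp [hclosed], 0, rfl, hclosed⟩
    · have hG : ∀ t : I, γ t ≠ v := fun t h =>
        Set.disjoint_left.1 hdisj ⟨t, rfl⟩ (Or.inl (h ▸ hv))
      have hcard : ∀ t : I, {e | (Fin.cons γ G.edge : Fin (G.numEdges + 1) →
          C(I, Plane)) e t = v}.ncard = {e | G.edge e t = v}.ncard := by
        intro t
        rw [hcons, ← Set.ncard_image_of_injective _ (Fin.succ_injective G.numEdges)]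
        simp [hG]
      rw [hcard, hcard]
      refine (G.three_le_degree v hv).imp_right (And.imp_right ?_)
      rintro ⟨e, he⟩
      exact ⟨e.succ, he⟩

section addLoop

variable (G : EmbeddedGraph) (γ : C(I, Plane)) (hclosed : γ 1 = γ 0)
  (hinj : Set.InjOn γ (Set.Ico 0 1)) (hdisj : Disjoint (Set.range γ) G.support)

theorem support_addLoop :
    (G.addLoop γ hclosed hinj hdisj).support = Set.range γ ∪ G.support := by
  have h : ⋃ e, Set.range ((G.addLoop γ hclosed hinj hdisj).edge e) =
      Set.range γ ∪ ⋃ e, Set.range (G.edge e) := by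
    ext x
    simp only [Set.mem_iUnion, Set.mem_union]
    exact Fin.exists_fin_succ
  have h' : ((G.addLoop γ hclosed hinj hdisj).verts : Set Plane) =
      insert (γ 0) (G.verts : Set Plane) :=
    Finset.coe_cons (h := fun h => Set.disjoint_left.1 hdisj ⟨0, rfl⟩ (Or.inl h))
  rw [support, h, h', support, Set.insert_eq, Set.union_assoc, Set.union_left_comm _ (Set.range γ),
    ← Set.union_assoc, Set.singleton_union, Set.insert_eq_of_mem (Set.mem_range_self 0)]

theorem length_addLoop :
    (G.addLoop γ hclosed hinj hdisj).length = eVariationOn γ Set.univ + G.length :=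
  Fin.sum_univ_succ _

end addLoop

end EmbeddedGraph

/-! ### Circles, and room for them in the exterior region -/

/-- The circle with center `c` and radius `r`, as a closed curve. -/
noncomputable def circleCurve (c : Plane) (r : ℝ) : C(I, Plane) :=
  ⟨fun t => c + Complex.orthonormalBasisOneI.repr (circleMap 0 r (2 * Real.pi * t)), by fun_prop⟩

theorem circleCurve_apply (c : Plane) (r : ℝ) (t : I) : circleCurve c r t =
    c + Complex.orthonormalBasisOneI.repr (circleMap 0 r (2 * Real.pi * t)) := rfl

theorem circleCurve_one (c : Plane) (r : ℝ) : circleCurve c r 1 = circleCurve c r 0 := by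
  simp [circleCurve_apply, circleMap]

theorem circleCurve_injOn (c : Plane) {r : ℝ} (hr : r ≠ 0) :
    Set.InjOn (circleCurve c r) (Set.Ico 0 1) := by
  intro s hs t ht h
  have h' := Complex.orthonormalBasisOneI.repr.injective (add_left_cancel h)
  have hmem : ∀ u ∈ Set.Ico (0 : I) 1, 2 * Real.pi * (u : ℝ) ∈ Set.Ico 0 (2 * Real.pi) :=
    fun u hu => ⟨mul_nonneg Real.two_pi_pos.le u.2.1,
      mul_lt_of_lt_one_right Real.two_pi_pos (Subtype.coe_lt_coe.2 hu.2)⟩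
  have := injOn_circleMap_of_abs_sub_le' hr (by simp) (hmem s hs) (hmem t ht) h'
  exact Subtype.ext (mul_left_cancel₀ Real.two_pi_pos.ne' this)

theorem range_circleCurve (c : Plane) {r : ℝ} (hr : 0 ≤ r) :
    Set.range (circleCurve c r) = Metric.sphere c r := by
  apply Set.Subset.antisymm
  · rintro _ ⟨t, rfl⟩
    simp [circleCurve_apply, abs_of_nonneg hr]
  · intro x hx
    have hz : Complex.orthonormalBasisOneI.repr.symm (x - c) ∈ Metric.sphere (0 : ℂ) |r| := by
      rw [mem_sphere_zero_iff_norm, LinearIsometryEquiv.norm_map, abs_of_nonneg hr]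
      exact mem_sphere_iff_norm.1 hx
    rw [← image_circleMap_Ioc] at hz
    obtain ⟨θ, hθ, hz⟩ := hz
    refine ⟨⟨θ / (2 * Real.pi), div_nonneg hθ.1.le Real.two_pi_pos.le,
      (div_le_one Real.two_pi_pos).2 hθ.2⟩, ?_⟩
    rw [circleCurve_apply, mul_div_cancel₀ θ Real.two_pi_pos.ne', hz,
      LinearIsometryEquiv.apply_symm_apply, add_sub_cancel]

theorem eVariationOn_circleCurve_le (c : Plane) {r : ℝ} (hr : 0 ≤ r) :
    eVariationOn (circleCurve c r) Set.univ ≤ ENNReal.ofReal (2 * Real.pi * r) := by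
  have hlip : LipschitzWith (Real.nnabs r) fun θ : ℝ =>
      c + Complex.orthonormalBasisOneI.repr (circleMap 0 r θ) := by
    intro x y
    rw [edist_add_left, LinearIsometryEquiv.edist_map]
    exact lipschitzWith_circleMap 0 r x y
  have hmono : MonotoneOn (fun t : I => 2 * Real.pi * (t : ℝ)) Set.univ := fun s _ t _ hst =>
    mul_le_mul_of_nonneg_left hst Real.two_pi_pos.le
  have hvar := (hmono.eVariationOn_eq (Set.mem_univ 0) (Set.mem_univ 1)).le
  rw [Set.univ_inter, Set.eq_univ_of_forall (s := Set.Icc (0 : I) 1) fun t => ⟨t.2.1, t.2.2⟩] at hvar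
  refine (hlip.lipschitzOnWith.comp_eVariationOn_le (Set.mapsTo_univ _ _)).trans
    ((mul_le_mul_right hvar _).trans_eq ?_)
  rw [← ENNReal.ofReal_coe_nnreal, ← ENNReal.ofReal_mul (NNReal.coe_nonneg _)]
  simp [abs_of_nonneg hr, mul_comm]

/-- Infinite area forces `U` to contain a point `x` outside a ball around `K`. The half-plane beyond
that ball in direction `x` misses `K` and is convex, hence connected, so it lies in `U`; it contains
discs of any radius. -/
theorem exists_closedBall_subset_of_open_cover {U V K : Set Plane} (hU : IsOpen U) (hV : IsOpen V)
    (hUV : Disjoint U V) (hcover : U ∪ V = Kᶜ) (hK : Bornology.IsBounded K)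
    (hvol : volume U = ∞) (r : ℝ) : ∃ c, Metric.closedBall c r ⊆ U := by
  obtain ⟨M, hM⟩ := hK.subset_closedBall 0
  -- The maximum with `0` ensures `x ≠ 0`, even if `M` is negative.
  obtain ⟨x, hxU, hx⟩ : ∃ x ∈ U, x ∉ Metric.closedBall (0 : Plane) (max M 0) := by
    by_contra! h
    exact ((measure_mono h).trans_lt measure_closedBall_lt_top).ne hvol
  rw [mem_closedBall_zero_iff, not_le, max_lt_iff] at hx
  set H : Set Plane := {y | M * ‖x‖ < inner ℝ x y} with hH
  have hxH : x ∈ H := by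
    rw [hH, Set.mem_ofPred_eq, real_inner_self_eq_norm_mul_norm]
    exact mul_lt_mul_of_pos_right hx.1 hx.2
  have hHK : H ⊆ U ∪ V := by
    rw [hcover]
    intro y hy hyK
    have h1 : ‖y‖ ≤ M := mem_closedBall_zero_iff.1 (hM hyK)
    have h2 : M * ‖x‖ < inner ℝ x y := hy
    nlinarith [real_inner_le_norm x y]
  have hconn : IsPreconnected H :=
    (convex_halfSpace_gt (innerSL ℝ x).isLinear (M * ‖x‖)).isPreconnected
  have hHU : H ⊆ U :=
    hconn.subset_left_of_subset_union hU hV hUV hHK ⟨x, hxH, hxU⟩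
  -- This center has distance greater than `r` from the boundary line of `H`.
  refine ⟨((|M| + |r| + 1) / ‖x‖) • x, fun y hy => hHU ?_⟩
  set c := ((|M| + |r| + 1) / ‖x‖) • x with hc
  have h1 : inner ℝ x c = (|M| + |r| + 1) * ‖x‖ := by
    rw [hc, real_inner_smul_right, real_inner_self_eq_norm_mul_norm]
    field_simp
  have h2 : |inner ℝ x (y - c)| ≤ ‖x‖ * r :=
    (abs_real_inner_le_norm x (y - c)).trans
      (mul_le_mul_of_nonneg_left (mem_closedBall_iff_norm.1 hy) (norm_nonneg x))
  have h3 : inner ℝ x y = inner ℝ x c + inner ℝ x (y - c) := by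
    rw [← inner_add_right, add_sub_cancel]
  have h4 := (abs_le.1 h2).1
  change M * ‖x‖ < inner ℝ x y
  nlinarith [le_abs_self M, le_abs_self r]

namespace EmbeddedGraph

/-- Regions may be disconnected, so the new disc can lie anywhere in the exterior region, whose area
stays infinite after its removal. `0 ≤ A i` makes `ENNReal.ofReal` additive here. -/
theorem Encloses.exists_add {G : EmbeddedGraph} {n : ℕ} {A : Fin n → ℝ} (h : G.Encloses A)
    (i : Fin n) (hA : 0 ≤ A i) {r : ℝ} (hr : 0 < r) :
    ∃ G' : EmbeddedGraph, G'.Encloses (A + Pi.single i (Real.pi * r ^ 2)) ∧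
      G'.length ≤ G.length + ENNReal.ofReal (2 * Real.pi * r) := by
  obtain ⟨R, hopen, hdisj, hun, hvol, hinf⟩ := h
  obtain ⟨c, hc⟩ : ∃ c, Metric.closedBall c r ⊆ R none := by
    refine exists_closedBall_subset_of_open_cover (hopen none)
      (isOpen_iUnion fun i => hopen (some i)) ?_ ?_ G.isBounded_support hinf r
    · exact Set.disjoint_iUnion_right.2 fun i => hdisj _ _ (by simp)
    · rw [← hun, Set.iUnion_option]
  have hcR : ∀ j, Disjoint (Metric.ball c r) (R (some j)) := fun j =>
    (hdisj none (some j) (by simp)).mono_left (Metric.ball_subset_closedBall.trans hc)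
  have hγ : Disjoint (Set.range (circleCurve c r)) G.support := by
    rw [range_circleCurve c hr.le, ← Set.subset_compl_iff_disjoint_right, ← hun]
    exact Metric.sphere_subset_closedBall.trans (hc.trans (Set.subset_iUnion R none))
  refine ⟨G.addLoop (circleCurve c r) (circleCurve_one c r) (circleCurve_injOn c hr.ne') hγ,
    ⟨fun o => o.elim (R none \ Metric.closedBall c r)
      fun j => if j = i then R (some j) ∪ Metric.ball c r else R (some j), ?_, ?_, ?_, ?_, ?_⟩, ?_⟩
  · rintro (_ | j)
    · exact (hopen none).sdiff Metric.isClosed_closedBall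
    · dsimp only [Option.elim]
      split_ifs
      exacts [(hopen _).union Metric.isOpen_ball, hopen _]
  · have h0 : ∀ j, Disjoint (R none \ Metric.closedBall c r)
        (if j = i then R (some j) ∪ Metric.ball c r else R (some j)) := by
      intro j
      have := (hdisj none (some j) (by simp)).mono_left
        (Set.sdiff_subset (t := Metric.closedBall c r))
      split_ifs
      exacts [this.union_right (Set.disjoint_sdiff_left.mono_right Metric.ball_subset_closedBall),
        this]
    rintro (_ | j) (_ | k) hjk
    · exact absurd rfl hjk
    · exact h0 k
    · exact (h0 j).symm
    · have hjk' := hdisj _ _ hjk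
      dsimp only [Option.elim]
      split_ifs with h1 h2 h2
      · exact absurd (congrArg some (h1.trans h2.symm)) hjk
      · exact hjk'.union_left (hcR k)
      · exact hjk'.union_right (hcR j).symm
      · exact hjk'
  · rw [support_addLoop, Set.compl_union, ← hun, range_circleCurve c hr.le, Set.iUnion_option,
      Set.iUnion_option]
    ext x
    simp only [Option.elim, Set.mem_union, Set.mem_sdiff, Set.mem_iUnion, Set.mem_inter_iff,
      Set.mem_compl_iff]
    have hcx : x ∈ Metric.closedBall c r ↔ x ∈ Metric.ball c r ∨ x ∈ Metric.sphere c r := by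
      rw [← Metric.ball_union_sphere]; rfl
    have hbs : x ∈ Metric.ball c r → x ∉ Metric.sphere c r :=
      fun h1 h2 => Set.disjoint_left.1 Metric.sphere_disjoint_ball h2 h1
    have hR : ∀ j, x ∈ R (some j) → x ∉ R none := fun j h1 h2 =>
      Set.disjoint_left.1 (hdisj none (some j) (by simp)) h2 h1
    have hR' : x ∈ Metric.closedBall c r → x ∈ R none := @hc x
    constructor
    · rintro (h1 | ⟨j, hj⟩)
      · exact ⟨fun h2 => h1.2 (hcx.2 (Or.inr h2)), Or.inl h1.1⟩
      · have hj' : x ∈ R (some j) ∨ x ∈ Metric.ball c r := by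
          split_ifs at hj
          exacts [hj, Or.inl hj]
        rcases hj' with hj | hj
        · exact ⟨fun h2 => hR j hj (hR' (hcx.2 (Or.inr h2))), Or.inr ⟨j, hj⟩⟩
        · exact ⟨hbs hj, Or.inl (hR' (hcx.2 (Or.inl hj)))⟩
    · rintro ⟨h1, h2 | ⟨j, hj⟩⟩
      · by_cases hx : x ∈ Metric.ball c r
        · exact Or.inr ⟨i, by simp [hx]⟩
        · exact Or.inl ⟨h2, fun h3 => (hcx.1 h3).elim hx h1⟩
      · refine Or.inr ⟨j, ?_⟩
        split_ifs
        exacts [Or.inl hj, hj]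
  · intro j
    dsimp only [Option.elim]
    split_ifs with hj
    · subst hj
      rw [measure_union (hcR j).symm measurableSet_ball, hvol,
        EuclideanSpace.volume_ball_fin_two, Pi.add_apply, Pi.single_eq_same,
        ENNReal.ofReal_add hA (by positivity)]
      congr 1
      rw [mul_comm Real.pi, ENNReal.ofReal_mul (by positivity), ENNReal.ofReal_pow hr.le]
    · rw [hvol, Pi.add_apply, Pi.single_eq_of_ne hj, add_zero]
  · exact measure_sdiff_eq_top hinf measure_closedBall_lt_top.ne
  · rw [length_addLoop, add_comm]
    gcongr
    exact eVariationOn_circleCurve_le c hr.le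

end EmbeddedGraph

/-! ### Estimates for the least length -/

theorem leastLength_le {n : ℕ} {A : Fin n → ℝ} {G : EmbeddedGraph} (h : G.Encloses A) :
    leastLength A ≤ G.length :=
  iInf₂_le G h

theorem leastLength_zero (n : ℕ) : leastLength (0 : Fin n → ℝ) = 0 :=
  le_antisymm ((leastLength_le (EmbeddedGraph.encloses_empty n)).trans_eq
    EmbeddedGraph.length_empty) zero_le

theorem leastLength_smul_le {n : ℕ} (A : Fin n → ℝ) {c : ℝ} (hc : c ≠ 0) :
    leastLength (c ^ 2 • A) ≤ ‖c‖₊ * leastLength A := by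
  have h0 : (‖c‖₊ : ℝ≥0∞) ≠ 0 := by simpa using hc
  rw [leastLength.eq_def A, ENNReal.mul_iInf_of_ne h0 ENNReal.coe_ne_top]
  refine le_iInf fun G => ?_
  rw [ENNReal.mul_iInf_of_ne h0 ENNReal.coe_ne_top]
  exact le_iInf fun h => (leastLength_le (h.scale c hc)).trans (G.length_scale_le c hc)

theorem leastLength_add_single_le {n : ℕ} (A : Fin n → ℝ) (i : Fin n) (hA : 0 ≤ A i) {δ : ℝ}
    (hδ : 0 ≤ δ) : leastLength (A + Pi.single i δ) ≤
      leastLength A + ENNReal.ofReal (2 * Real.pi * √(δ / Real.pi)) := by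
  -- A circle of radius zero is not a simple curve, so `δ = 0` is separate.
  rcases hδ.eq_or_lt with rfl | hδ
  · simp
  have hr : Real.pi * √(δ / Real.pi) ^ 2 = δ := by
    rw [Real.sq_sqrt (by positivity), mul_div_cancel₀ _ Real.pi_ne_zero]
  rw [leastLength.eq_def A, ENNReal.iInf_add]
  refine le_iInf fun G => ?_
  rw [ENNReal.iInf_add]
  refine le_iInf fun h => ?_
  obtain ⟨G', hG', hlen⟩ := h.exists_add i hA (Real.sqrt_pos.2 (div_pos hδ Real.pi_pos))
  rw [hr] at hG'
  exact (leastLength_le hG').trans hlen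

theorem leastLength_add_le {n : ℕ} {A D : Fin n → ℝ} (hA : 0 ≤ A) (hD : 0 ≤ D) :
    leastLength (A + D) ≤
      leastLength A + ENNReal.ofReal (∑ i, 2 * Real.pi * √(D i / Real.pi)) := by
  have key : ∀ s : Finset (Fin n), leastLength (A + ∑ i ∈ s, Pi.single i (D i)) ≤
      leastLength A + ENNReal.ofReal (∑ i ∈ s, 2 * Real.pi * √(D i / Real.pi)) := by
    intro s
    induction s using Finset.induction_on with
    | empty => simp
    | insert i s hi ih =>
      rw [Finset.sum_insert hi, Finset.sum_insert hi, add_comm (Pi.single (M := fun _ => ℝ) i (D i)),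
        ← add_assoc,
        add_comm (2 * Real.pi * _), ENNReal.ofReal_add (Finset.sum_nonneg fun _ _ => by positivity)
        (by positivity), ← add_assoc]
      refine (leastLength_add_single_le _ i ?_ (hD i)).trans (add_le_add_left ih _)
      rw [Pi.add_apply, Finset.sum_apply]
      refine add_nonneg (hA i) (Finset.sum_nonneg fun j _ => ?_)
      have h : (0 : Fin n → ℝ) ≤ Pi.single j (D j) := Pi.single_nonneg.2 (hD j)
      exact h i
  simpa only [Finset.univ_sum_single] using key Finset.univ

theorem leastLength_ne_top {n : ℕ} {A : Fin n → ℝ} (hA : 0 ≤ A) : leastLength A ≠ ∞ := by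
  have h := leastLength_add_le le_rfl hA
  rw [zero_add, leastLength_zero, zero_add] at h
  exact ne_top_of_le_ne_top ENNReal.ofReal_ne_top h

/-! ### Comparison of nearby areas and continuity -/

/-- A factor `s` with `s • A ≤ B`, close to `1` if `B` is close to `A`. -/
noncomputable def shrinkFactor {n : ℕ} (A B : Fin n → ℝ) : ℝ := 1 - ∑ i, |1 - B i / A i|

theorem shrinkFactor_self {n : ℕ} {A : Fin n → ℝ} (hA : ∀ i, 0 < A i) : shrinkFactor A A = 1 := by
  simp [shrinkFactor, div_self (hA _).ne']

/-- The sum of deviations dominates each `1 - B i / A i`; unlike a minimum of ratios, it needs no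
choice of index. -/
theorem shrinkFactor_smul_le {n : ℕ} {A : Fin n → ℝ} (hA : ∀ i, 0 < A i) (B : Fin n → ℝ) :
    shrinkFactor A B • A ≤ B := by
  intro i
  have h := Finset.single_le_sum (f := fun i => |1 - B i / A i|) (fun _ _ => abs_nonneg _)
    (Finset.mem_univ i)
  rw [Pi.smul_apply, smul_eq_mul, ← le_div_iff₀ (hA i), shrinkFactor]
  linarith [le_abs_self (1 - B i / A i)]

/-- The length of disjoint circles that fill up the areas `shrinkFactor A B • A` to `B`. -/
noncomputable def fillLength {n : ℕ} (A B : Fin n → ℝ) : ℝ :=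
  ∑ i, 2 * Real.pi * √((B i - shrinkFactor A B * A i) / Real.pi)

theorem fillLength_self {n : ℕ} {A : Fin n → ℝ} (hA : ∀ i, 0 < A i) : fillLength A A = 0 := by
  simp [fillLength, shrinkFactor_self hA]

theorem toReal_leastLength_le {n : ℕ} {A B : Fin n → ℝ} (hA : ∀ i, 0 < A i)
    (hs : 0 < shrinkFactor A B) : (leastLength B).toReal ≤
      √(shrinkFactor A B) * (leastLength A).toReal + fillLength A B := by
  have hA' : 0 ≤ A := fun i => (hA i).le
  have hs' := Real.sqrt_pos.2 hs
  have hsc := leastLength_smul_le A hs'.ne'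
  rw [Real.sq_sqrt hs.le] at hsc
  have hadd := leastLength_add_le (smul_nonneg hs.le hA')
    (sub_nonneg.2 (shrinkFactor_smul_le hA B))
  rw [add_sub_cancel] at hadd
  have hfill : 0 ≤ fillLength A B := Finset.sum_nonneg fun _ _ => by positivity
  have h := ENNReal.toReal_mono (ENNReal.add_ne_top.2 ⟨ENNReal.mul_ne_top ENNReal.coe_ne_top
    (leastLength_ne_top hA'), ENNReal.ofReal_ne_top⟩) (hadd.trans (add_le_add_left hsc _))
  rw [ENNReal.toReal_add (ENNReal.mul_ne_top ENNReal.coe_ne_top (leastLength_ne_top hA'))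
    ENNReal.ofReal_ne_top, ENNReal.toReal_mul] at h
  change _ ≤ _ + (ENNReal.ofReal (fillLength A B)).toReal at h
  rw [ENNReal.toReal_ofReal hfill] at h
  simpa [abs_of_pos hs'] using h

theorem continuousAt_leastLength {n : ℕ} {A : Fin n → ℝ} (hA : ∀ i, 0 < A i) :
    ContinuousAt (fun B : Fin n → ℝ => (leastLength B).toReal) A := by
  have hA' : ∀ i, A i ≠ 0 := fun i => (hA i).ne'
  have hc : ∀ i, ContinuousAt (fun B : Fin n → ℝ => B i) A := fun i =>
    (continuous_apply i).continuousAt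
  have hs : ContinuousAt (fun B => shrinkFactor A B) A := by
    exact continuousAt_const.sub (tendsto_finsetSum _ fun i _ => (continuousAt_const.sub
      ((hc i).div_const _)).abs)
  have hs' : ContinuousAt (fun B => shrinkFactor B A) A := by
    exact continuousAt_const.sub (tendsto_finsetSum _ fun i _ => (continuousAt_const.sub
      (continuousAt_const.div (hc i) (hA' i))).abs)
  have hf : ContinuousAt (fun B => fillLength A B) A := by
    exact tendsto_finsetSum _ fun i _ => continuousAt_const.mul
      (((hc i).sub (hs.mul continuousAt_const)).div_const _).sqrt
  have hf' : ContinuousAt (fun B => fillLength B A) A := by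
    exact tendsto_finsetSum _ fun i _ => continuousAt_const.mul
      ((continuousAt_const.sub (hs'.mul (hc i))).div_const _).sqrt
  have hpos : ∀ᶠ B in 𝓝 A, ∀ i, 0 < B i :=
    eventually_all.2 fun i => (hc i).eventually (lt_mem_nhds (hA i))
  have hspos : ∀ᶠ B in 𝓝 A, 0 < shrinkFactor A B :=
    hs.eventually (lt_mem_nhds (by simp [shrinkFactor_self hA]))
  have hspos' : ∀ᶠ B in 𝓝 A, 0 < shrinkFactor B A :=
    hs'.eventually (lt_mem_nhds (by simp [shrinkFactor_self hA]))
  have hup : ContinuousAt (fun B => √(shrinkFactor A B) * (leastLength A).toReal +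
      fillLength A B) A := by fun_prop
  -- The comparison with `A` and `B` exchanged, solved for `L(B)`.
  have hlow : ContinuousAt (fun B => ((leastLength A).toReal - fillLength B A) /
      √(shrinkFactor B A)) A :=
    (continuousAt_const.sub hf').div hs'.sqrt (by simp [shrinkFactor_self hA])
  refine tendsto_of_tendsto_of_tendsto_of_le_of_le'
    (by simpa [ContinuousAt, shrinkFactor_self hA, fillLength_self hA] using hlow)
    (by simpa [ContinuousAt, shrinkFactor_self hA, fillLength_self hA] using hup) ?_ ?_
  · filter_upwards [hpos, hspos'] with B hB hsB
    rw [div_le_iff₀ (Real.sqrt_pos.2 hsB)]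
    linarith [toReal_leastLength_le hB hsB]
  · filter_upwards [hspos] with B hsB
    exact toReal_leastLength_le hA hsB

theorem lemma2p2 :
    (∀ A : Fin 3 → ℝ, (∀ i, 0 < A i) → leastLength A ≠ ∞) ∧
    ContinuousOn (fun A : Fin 3 → ℝ => (leastLength A).toReal) {A | ∀ i, 0 < A i} :=
  ⟨fun _ hA => leastLength_ne_top fun i => (hA i).le,
    fun _ hA => (continuousAt_leastLength hA).continuousWithinAt⟩
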